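/- Let $n\in\mathbb N$, let $\Omega\subset\mathbb R^n$ be open, let $1\le p\le\infty$, let $L^p(\Omega)$ be the space of real-valued $L^p$ functions on $\Omega$ (with Lebesgue measure), let $A:L^p(\Omega)\to L^p(\Omega)$ be a bounded linear operator, let $u_0\in L^p(\Omega)$, and let $\alpha\in L^\infty(\Omega)$ satisfy $\alpha(x)\in[\alpha_0,1]$ for almost every $x\in\Omega$, for some $\alpha_0\in(0,1)$. For $\beta:\Omega\to[0,1]$ and a function $\varphi$ of $(t,x)$, put $$J_t^{\beta(x)}\varphi(t,x)=\frac1{\Gamma(\beta(x))}\int_0^t(t-s)^{\beta(x)-1}\varphi(s,x)\,ds\ \text{ if }\beta(x)\in(0,1],\qquad J_t^{\beta(x)}\varphi(t,x)=\varphi(t,x)\ \text{ if }\beta(x)=0,$$ whenever the right-hand side exists. For a continuous curve $\varphi$ in $L^p(\Omega)$, $\varphi(t,x)$ denotes a jointly measurable representative. The Caputo derivative of order $\alpha(x)$ is $$cD_t^{\alpha(x)}\varphi(t,\cdot)=\frac{d}{dt}\Big\{J_t^{1-\alpha(x)}\big[\varphi(t,x)-\varphi(0,x)\big]\Big\},$$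 where $J_t^{1-\alpha(x)}[\varphi(t,x)-\varphi(0,x)]$ is required to exist for almost every $x$ and to define an element of $L^p(\Omega)$ for every $t$ considered, and $\frac{d}{dt}$ is the derivative in the norm of $L^p(\Omega)$ (one-sided at endpoints of the time interval). Let $f:[0,\infty)\times L^p(\Omega)\to L^p(\Omega)$ be continuous and locally Lipschitz in the second variable, uniformly with respect to the first: for every $(t_0,\phi_0)\in[0,\infty)\times L^p(\Omega)$ there are $r_0,L_0>0$ such that $\|f(t,\psi)-f(t,\phi)\|_{L^p(\Omega)}\le L_0\|\psi-\phi\|_{L^p(\Omega)}$ whenever $t\ge0$, $|t-t_0|+\|\psi-\phi_0\|_{L^p(\Omega)}<r_0$ and $|t-t_0|+\|\phi-\phi_0\|_{L^p(\Omega)}<r_0$. Then there exists $\tau_0>0$ such that the problem $$cD_t^{\alpha(x)}u(t,\cdot)=Au(t,\cdot)+f(t,u(t,\cdot)),\qquad u(0,\cdot)=u_0,$$ has a unique solution in $[0,\tau_0]\times\Omega$, that is, there is exactly one $u\in C([0,\tau_0];L^p(\Omega))$ with $u(0,\cdot)=u_0$ for which $cD_t^{\alpha(x)}u(t,\cdot)$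 exists and the equation holds in $L^p(\Omega)$ for every $t\in[0,\tau_0]$. -/

import Mathlib

open MeasureTheory Set
open scoped ENNReal

noncomputable section

namespace VariableOrder

variable {X : Type*} [MeasurableSpace X]

/-- The Riemann-Liouville fractional integral `J_t^{β(x)} Φ(t,x)` of variable order `β : X → [0,1]`
of a function `Φ` of time and space. -/
def rlIntegral (β : X → ℝ) (Φ : ℝ → X → ℝ) (t : ℝ) (x : X) : ℝ :=
  if β x = 0 then Φ t x
  else (1 / Real.Gamma (β x)) * ∫ s in (0 : ℝ)..t, (t - s) ^ (β x - 1) * Φ s x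

/-- The right-hand side defining `J_t^{β(x)} Φ(t,x)` exists: nothing is required where `β x = 0`,
and elsewhere the integrand is Lebesgue integrable between `0` and `t`. -/
def RLIntegralExists (β : X → ℝ) (Φ : ℝ → X → ℝ) (t : ℝ) (x : X) : Prop :=
  β x = 0 ∨ IntervalIntegrable (fun s => (t - s) ^ (β x - 1) * Φ s x) volume 0 t

variable {μ : Measure X} {p : ℝ≥0∞}

/-- `Φ(t,x)` is a jointly measurable function on `I × X` which, for every `t ∈ I`, represents the
class `φ t ∈ L^p(μ)`. This is what is meant by writing `φ : I → L^p(μ)` as `φ(t,x)`. -/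
def IsRepresentativeOn (I : Set ℝ) (Φ : ℝ → X → ℝ) (φ : ℝ → Lp ℝ p μ) : Prop :=
  AEStronglyMeasurable (fun z : ℝ × X => Φ z.1 z.2) ((volume.restrict I).prod μ) ∧
    ∀ t ∈ I, Φ t =ᵐ[μ] φ t

/-- `v = J_t^{β(x)} φ` on `I`, for curves `φ` and `v` in `L^p(μ)`: for every `t ∈ I` and almost
every `x`, the fractional integral of order `β(x)` of `φ(·,x)` at time `t` exists and is
`v(t,x)`. -/
def IsRLIntegralOn (I : Set ℝ) (β : X → ℝ) (φ v : ℝ → Lp ℝ p μ) : Prop :=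
  ∃ Φ : ℝ → X → ℝ, IsRepresentativeOn I Φ φ ∧
    ∀ t ∈ I, ∀ᵐ x ∂μ, RLIntegralExists β Φ t x ∧ v t x = rlIntegral β Φ t x

/-- The Riemann-Liouville derivative `D_t^{α(x)} φ = d/dt (J_t^{1-α(x)} φ)` exists at every time
in `I` and is `w` there. The derivative is that of a curve in the normed space `L^p(μ)`, one-sided
at the endpoints of `I`. -/
def HasRLDerivOn [Fact (1 ≤ p)] (I : Set ℝ) (α : X → ℝ) (φ w : ℝ → Lp ℝ p μ) : Prop :=
  ∃ v : ℝ → Lp ℝ p μ, IsRLIntegralOn I (fun x => 1 - α x) φ v ∧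
    ∀ t ∈ I, HasDerivWithinAt v (w t) I t

/-- The Caputo derivative `cD_t^{α(x)} φ = D_t^{α(x)} [φ - φ(0)]` exists at every time in `I` and
is `w` there. -/
def HasCaputoDerivOn [Fact (1 ≤ p)] (I : Set ℝ) (α : X → ℝ) (φ w : ℝ → Lp ℝ p μ) : Prop :=
  HasRLDerivOn I α (fun t => φ t - φ 0) w

/-- `φ ∈ C(I; L^p(μ))` is a solution on `I` of `cD_t^{α(x)} u = A u + f(t,u)`, `u(0) = u₀`. Only
the values of `φ` on `I` matter (for `0 ∈ I`). -/
structure IsSolutionOn [Fact (1 ≤ p)] (I : Set ℝ) (α : X → ℝ) (A : Lp ℝ p μ →L[ℝ] Lp ℝ p μ)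
    (f : ℝ → Lp ℝ p μ → Lp ℝ p μ) (u₀ : Lp ℝ p μ) (φ : ℝ → Lp ℝ p μ) : Prop where
  continuousOn : ContinuousOn φ I
  equation : HasCaputoDerivOn I α φ (fun t => A (φ t) + f t (φ t))
  initial : φ 0 = u₀

/-- `f : [0,∞) × E → E` is locally Lipschitz in the second variable, uniformly with respect to the
first one. Values of `f` at negative times are irrelevant. -/
def LocLipschitzSnd {E : Type*} [NormedAddCommGroup E] (f : ℝ → E → E) : Prop :=
  ∀ t₀ : ℝ, 0 ≤ t₀ → ∀ φ₀ : E, ∃ r₀ > (0 : ℝ), ∃ L₀ > (0 : ℝ), ∀ t : ℝ, 0 ≤ t → ∀ ψ φ : E,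
    |t - t₀| + ‖ψ - φ₀‖ < r₀ → |t - t₀| + ‖φ - φ₀‖ < r₀ → ‖f t ψ - f t φ‖ ≤ L₀ * ‖ψ - φ‖

end VariableOrder

end

/-! The Cauchy problem is equivalent to the Volterra equation `u = u₀ + J_t^{α(x)}[A u + f(t,u)]`,
which a contraction argument solves on a short interval.

The operator `J_t^{α(x)}` is a convolution in time whose kernel takes values in the bounded
operators on `L^p`: at lag `r` it multiplies by `r^(α(x)-1)/Γ(α(x))`. Since `α ≥ α₀ > 0`, its norm
is at most `C r^(α₀-1)` for `0 < r ≤ 1`, an integrable singularity. `exists_unique_volterra` then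
gives a unique solution among all continuous curves, not merely those in a small ball.

The equivalence rests on Abel's identity `J^{1-α} J^{α} = J^1` (`integral_abel`). It shows that
`J^{α} g` has Riemann-Liouville derivative `g` (`hasRLDerivOn_bochnerRL`). The same identity makes
`J^{1-α}` injective on continuous curves (`IsRLIntegralOn.eq_zero`), and so a curve vanishing at
time zero is recovered from its continuous derivative (`HasRLDerivOn.eqOn_bochnerRL`).

Abel's identity is pointwise in `x`, whereas the Volterra equation uses Bochner integrals in `L^p`.
The bridge is `ae_integrable_and_integral_eq`, applied to jointly measurable representatives; it
covers `p = ∞` too. -/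

namespace VariableOrder

/-! ### Volterra equations with a weakly singular operator kernel -/

section Volterra

open Filter Topology

/-- A continuous curve on a compact interval has a bounded uniformly continuous extension to the
line. -/
lemma exists_continuous_extension {E : Type*} [NormedAddCommGroup E] {h : ℝ → E} {T : ℝ}
    (hT : 0 ≤ T) (hh : ContinuousOn h (Icc 0 T)) :
    ∃ g : ℝ → E, UniformContinuous g ∧ EqOn g h (Icc 0 T) ∧ ∃ M, ∀ t, ‖g t‖ ≤ M := by
  obtain ⟨M, hM⟩ := isCompact_Icc.exists_bound_of_continuousOn hh
  refine ⟨IccExtend hT ((Icc 0 T).domRestrict h), ?_, ?_, M, ?_⟩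
  · exact (CompactSpace.uniformContinuous_of_continuous
      (continuousOn_iff_continuous_domRestrict.1 hh)).comp
      (LipschitzWith.projIcc hT).uniformContinuous
  · intro t ht
    rw [IccExtend_of_mem _ _ ht]
    rfl
  · intro t
    exact hM _ (projIcc 0 T hT t).2

variable {E : Type*} [NormedAddCommGroup E] [NormedSpace ℝ E]

/-- The Volterra integral `∫₀ᵗ K(r) h(t - r) dr` with an operator-valued convolution kernel. -/
noncomputable def volterra (K : ℝ → E →L[ℝ] E) (h : ℝ → E) (t : ℝ) : E :=
  ∫ r in (0 : ℝ)..t, K r (h (t - r))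

lemma volterra_congr (K : ℝ → E →L[ℝ] E) {h g : ℝ → E} {T t : ℝ} (ht : t ∈ Icc 0 T)
    (hhg : EqOn h g (Icc 0 T)) : volterra K h t = volterra K g t := by
  refine intervalIntegral.integral_congr fun r hr => ?_
  rw [uIcc_of_le ht.1] at hr
  rw [hhg ⟨by linarith [hr.2], by linarith [hr.1, ht.2]⟩]

variable {K : ℝ → E →L[ℝ] E} {C a : ℝ}

lemma intervalIntegrable_kernel_bound (ha : 0 < a) (D s t : ℝ) :
    IntervalIntegrable (fun r : ℝ => D * r ^ (a - 1)) volume s t :=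
  (intervalIntegral.intervalIntegrable_rpow' (by linarith)).const_mul _

lemma integral_kernel_bound (ha : 0 < a) (D t : ℝ) :
    ∫ r in (0 : ℝ)..t, D * r ^ (a - 1) = D * (t ^ a / a) := by
  rw [intervalIntegral.integral_const_mul, integral_rpow (Or.inl (by linarith))]
  simp [Real.zero_rpow ha.ne']

lemma aestronglyMeasurable_kernel (hK : ContinuousOn K (Ioi 0)) {h : ℝ → E} {T t : ℝ}
    (ht : t ∈ Icc 0 T) (hh : ContinuousOn h (Icc 0 T)) :
    AEStronglyMeasurable (fun r => K r (h (t - r))) (volume.restrict (Ioc 0 t)) := by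
  refine ContinuousOn.aestronglyMeasurable ?_ measurableSet_Ioc
  refine (hK.mono fun r hr => hr.1).clm_apply (hh.comp (by fun_prop) fun r hr => ?_)
  exact ⟨by linarith [hr.2], by linarith [hr.1, ht.2]⟩

lemma intervalIntegrable_volterra (hK : ContinuousOn K (Ioi 0)) (ha : 0 < a)
    (hKb : ∀ r ∈ Ioc (0 : ℝ) 1, ‖K r‖ ≤ C * r ^ (a - 1)) {h : ℝ → E} {T t : ℝ} (hT : T ≤ 1)
    (ht : t ∈ Icc 0 T) (hh : ContinuousOn h (Icc 0 T)) :
    IntervalIntegrable (fun r => K r (h (t - r))) volume 0 t := by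
  obtain ⟨M, hM⟩ := isCompact_Icc.exists_bound_of_continuousOn hh
  have hb := intervalIntegrable_kernel_bound ha (C * M) 0 t
  rw [intervalIntegrable_iff_integrableOn_Ioc_of_le ht.1] at hb ⊢
  refine Integrable.mono' hb (aestronglyMeasurable_kernel hK ht hh) ?_
  refine (ae_restrict_iff' measurableSet_Ioc).2 (.of_forall fun r hr => ?_)
  have h1 := hKb r ⟨hr.1, by linarith [hr.2, ht.2]⟩
  have h2 := hM (t - r) ⟨by linarith [hr.2], by linarith [hr.1, ht.2]⟩
  calc ‖K r (h (t - r))‖ ≤ ‖K r‖ * ‖h (t - r)‖ := (K r).le_opNorm _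
    _ ≤ C * r ^ (a - 1) * M :=
      mul_le_mul h1 h2 (norm_nonneg _) ((norm_nonneg _).trans h1)
    _ = _ := by ring

lemma norm_volterra_le (ha : 0 < a)
    (hKb : ∀ r ∈ Ioc (0 : ℝ) 1, ‖K r‖ ≤ C * r ^ (a - 1)) {h : ℝ → E} {t M : ℝ}
    (ht : t ∈ Icc (0 : ℝ) 1) (hM : ∀ s ∈ Icc 0 t, ‖h s‖ ≤ M) :
    ‖volterra K h t‖ ≤ C * M * (t ^ a / a) := by
  rw [← integral_kernel_bound ha]
  refine intervalIntegral.norm_integral_le_of_norm_le ht.1 (.of_forall fun r hr => ?_)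
    (intervalIntegrable_kernel_bound ha _ _ _)
  have h1 := hKb r ⟨hr.1, by linarith [hr.2, ht.2]⟩
  have h2 := hM (t - r) ⟨by linarith [hr.2], by linarith [hr.1]⟩
  calc ‖K r (h (t - r))‖ ≤ ‖K r‖ * ‖h (t - r)‖ := (K r).le_opNorm _
    _ ≤ C * r ^ (a - 1) * M :=
      mul_le_mul h1 h2 (norm_nonneg _) ((norm_nonneg _).trans h1)
    _ = _ := by ring

lemma volterra_sub (hK : ContinuousOn K (Ioi 0)) (ha : 0 < a)
    (hKb : ∀ r ∈ Ioc (0 : ℝ) 1, ‖K r‖ ≤ C * r ^ (a - 1)) {h g : ℝ → E} {T t : ℝ} (hT : T ≤ 1)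
    (ht : t ∈ Icc 0 T) (hh : ContinuousOn h (Icc 0 T)) (hg : ContinuousOn g (Icc 0 T)) :
    volterra K h t - volterra K g t = volterra K (fun s => h s - g s) t := by
  rw [volterra, volterra, ← intervalIntegral.integral_sub
    (intervalIntegrable_volterra hK ha hKb hT ht hh)
    (intervalIntegrable_volterra hK ha hKb hT ht hg)]
  simp [volterra]

/-- In convolution form the singularity stays at `r = 0` for every `t`, so a single bound `C M
r^(a-1)` dominates all integrands. Extending `h` to the line and cutting off with an indicator gives
a domain independent of `t`. -/
lemma continuousOn_volterra (hK : ContinuousOn K (Ioi 0)) (ha : 0 < a)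
    (hKb : ∀ r ∈ Ioc (0 : ℝ) 1, ‖K r‖ ≤ C * r ^ (a - 1)) {h : ℝ → E} {T : ℝ} (hT0 : 0 ≤ T)
    (hT : T ≤ 1) (hh : ContinuousOn h (Icc 0 T)) : ContinuousOn (volterra K h) (Icc 0 T) := by
  obtain ⟨g, hgu, hgh, M, hM⟩ := exists_continuous_extension hT0 hh
  have hg := hgu.continuous
  have key : Continuous fun t =>
      ∫ r in Ioc 0 T, (Iio t).indicator (fun r => K r (g (t - r))) r := by
    refine continuous_iff_continuousAt.2 fun t₀ => ?_
    refine continuousAt_of_dominated (bound := fun r => C * M * r ^ (a - 1)) ?_ ?_ ?_ ?_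
    · refine .of_forall fun t => AEStronglyMeasurable.indicator ?_ measurableSet_Iio
      exact ((hK.mono fun r hr => hr.1).clm_apply (by fun_prop)).aestronglyMeasurable
        measurableSet_Ioc
    · refine .of_forall fun t => (ae_restrict_iff' measurableSet_Ioc).2 (.of_forall fun r hr => ?_)
      have h1 := hKb r ⟨hr.1, by linarith [hr.2]⟩
      refine (norm_indicator_le_norm_self _ _).trans ?_
      calc ‖K r (g (t - r))‖ ≤ ‖K r‖ * ‖g (t - r)‖ := (K r).le_opNorm _
        _ ≤ C * r ^ (a - 1) * M :=
          mul_le_mul h1 (hM _) (norm_nonneg _) ((norm_nonneg _).trans h1)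
        _ = _ := by ring
    · have := intervalIntegrable_kernel_bound ha (C * M) 0 T
      rwa [intervalIntegrable_iff_integrableOn_Ioc_of_le hT0] at this
    -- The cutoff is continuous in `t` at `t₀` except for the single lag `r = t₀`.
    · have hne : ∀ᵐ r ∂(volume.restrict (Ioc 0 T)), r ≠ t₀ :=
        ae_restrict_of_ae (by simp [ae_iff])
      filter_upwards [hne] with r hr
      rcases lt_or_gt_of_ne hr with hr | hr
      · have : (fun t => K r (g (t - r))) =ᶠ[𝓝 t₀]
            fun t => (Iio t).indicator (fun r => K r (g (t - r))) r := by
          filter_upwards [Ioi_mem_nhds hr] with t ht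
          rw [indicator_of_mem (by exact ht)]
        exact ContinuousAt.congr (by fun_prop) this
      · have : (fun _ => (0 : E)) =ᶠ[𝓝 t₀]
            fun t => (Iio t).indicator (fun r => K r (g (t - r))) r := by
          filter_upwards [Iio_mem_nhds hr] with t ht
          rw [indicator_of_notMem (by simpa using ht.le)]
        exact ContinuousAt.congr (by fun_prop) this
  refine key.continuousOn.congr fun t ht => ?_
  beta_reduce
  rw [volterra_congr K ht hgh.symm, volterra, intervalIntegral.integral_of_le ht.1,
    setIntegral_indicator measurableSet_Iio, integral_Ioc_eq_integral_Ioo]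
  congr 2
  ext r
  simp only [mem_Ioo, mem_inter_iff, mem_Ioc, mem_Iio]
  exact ⟨fun h => ⟨⟨h.1, h.2.le.trans ht.2⟩, h.2⟩, fun h => ⟨h.1.1, h.2⟩⟩

lemma exists_pos_rpow_mul_le (ha : 0 < a) (B : ℝ) {ε δ : ℝ} (hε : 0 < ε) (hδ : 0 < δ) :
    ∃ τ, 0 < τ ∧ τ ≤ δ ∧ ∀ t ∈ Icc 0 τ, B * (t ^ a / a) ≤ ε := by
  have hc : ContinuousAt (fun t : ℝ => B * (t ^ a / a)) 0 :=
    ((Real.continuousAt_rpow_const 0 a (Or.inr ha.le)).div_const a).const_mul B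
  have h0 : (fun t : ℝ => B * (t ^ a / a)) 0 < ε := by simpa [Real.zero_rpow ha.ne'] using hε
  obtain ⟨η, hη, hb⟩ := Metric.eventually_nhds_iff.1 (hc.eventually (gt_mem_nhds h0))
  refine ⟨min δ (η / 2), by positivity, min_le_left _ _, fun t ht => (hb ?_).le⟩
  rw [Real.dist_eq, sub_zero, abs_of_nonneg ht.1]
  linarith [ht.2, min_le_right δ (η / 2)]

/-- A solution of a Volterra equation cannot leave a ball whose half it is trapped in as long as
it stays in the ball. -/
lemma norm_sub_le_of_trapped {E : Type*} [NormedAddCommGroup E] {ψ : ℝ → E} {u₀ : E} {τ ρ : ℝ}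
    (hρ : 0 < ρ)
    (hψ : ContinuousOn ψ (Icc 0 τ)) (h0 : ψ 0 = u₀)
    (htrap : ∀ t ∈ Icc 0 τ, (∀ s ∈ Icc 0 t, ‖ψ s - u₀‖ ≤ ρ) → ‖ψ t - u₀‖ ≤ ρ / 2) :
    ∀ t ∈ Icc 0 τ, ‖ψ t - u₀‖ ≤ ρ := by
  by_contra! hcon
  obtain ⟨t, ht, hlt⟩ := hcon
  have hcont : ContinuousOn (fun s => ‖ψ s - u₀‖) (Icc 0 τ) := by fun_prop
  set S := Icc 0 τ ∩ (fun s => ‖ψ s - u₀‖) ⁻¹' Ici ρ with hS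
  have hSc : IsCompact S :=
    isCompact_Icc.of_isClosed_subset (hcont.preimage_isClosed_of_isClosed isClosed_Icc isClosed_Ici)
      inter_subset_left
  -- `m` is the first time at distance at least `ρ`. By continuity the curve stays in the ball up to
  -- and including `m`, so trapping applies there and contradicts `ρ > 0`.
  obtain ⟨m, hm, hmin⟩ := hSc.exists_isLeast ⟨t, ht, hlt.le⟩
  have hm0 : 0 < m := by
    rcases hm.1.1.eq_or_lt with h | h
    · have := hm.2
      rw [← h] at this
      simp only [mem_preimage, h0, sub_self, norm_zero, mem_Ici] at this
      linarith
    · exact h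
  have hlt : ∀ s ∈ Ico 0 m, ‖ψ s - u₀‖ ≤ ρ := fun s hs => by
    by_contra! hc
    exact absurd (hmin ⟨⟨hs.1, hs.2.le.trans hm.1.2⟩, hc.le⟩) (not_le.2 hs.2)
  have hle : ∀ s ∈ Icc 0 m, ‖ψ s - u₀‖ ≤ ρ := by
    intro s hs
    rw [← closure_Ico hm0.ne] at hs
    refine le_on_closure (f := fun s => ‖ψ s - u₀‖) (g := fun _ => ρ) hlt ?_ continuousOn_const hs
    rw [closure_Ico hm0.ne]
    exact hcont.mono (Icc_subset_Icc_right hm.1.2)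
  have h1 := htrap m hm.1 hle
  have h2 : ρ ≤ ‖ψ m - u₀‖ := hm.2
  linarith

variable [CompleteSpace E]

/-- Local existence and uniqueness for a Volterra equation with a weakly singular operator-valued
convolution kernel and a locally Lipschitz nonlinearity. -/
theorem exists_unique_volterra (ha : 0 < a) (hK : ContinuousOn K (Ioi 0))
    (hKb : ∀ r ∈ Ioc (0 : ℝ) 1, ‖K r‖ ≤ C * r ^ (a - 1)) {F : ℝ → E → E}
    (hF : ContinuousOn (fun z : ℝ × E => F z.1 z.2) (Ici (0 : ℝ) ×ˢ univ))
    (hFL : LocLipschitzSnd F) (u₀ : E) :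
    ∃ τ, 0 < τ ∧ τ ≤ 1 ∧ ∃ u : ℝ → E, ContinuousOn u (Icc 0 τ) ∧
      (∀ t ∈ Icc 0 τ, u t = u₀ + volterra K (fun s => F s (u s)) t) ∧
      ∀ ψ : ℝ → E, ContinuousOn ψ (Icc 0 τ) →
        (∀ t ∈ Icc 0 τ, ψ t = u₀ + volterra K (fun s => F s (ψ s)) t) → EqOn ψ u (Icc 0 τ) := by
  obtain ⟨r₀, hr₀, L, hL, hLip⟩ := hFL 0 le_rfl u₀
  -- The Lipschitz hypothesis bounds the sum of the time and space distances; a quarter of `r₀` for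
  -- each keeps it strictly below `r₀`.
  set ρ := r₀ / 4 with hρ
  set δ := min 1 (r₀ / 4) with hδ
  have hρ0 : 0 < ρ := by positivity
  have hδ0 : 0 < δ := by positivity
  have hLip' : ∀ s ∈ Icc 0 δ, ∀ v w : E, ‖v - u₀‖ ≤ ρ → ‖w - u₀‖ ≤ ρ →
      ‖F s v - F s w‖ ≤ L * ‖v - w‖ := by
    intro s hs v w hv hw
    have : |s - 0| ≤ r₀ / 4 := by
      rw [sub_zero, abs_of_nonneg hs.1]; exact hs.2.trans (min_le_right _ _)
    exact hLip s hs.1 v w (by linarith) (by linarith)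
  have hFc : ∀ {τ : ℝ} {ψ : ℝ → E}, ContinuousOn ψ (Icc 0 τ) →
      ContinuousOn (fun s => F s (ψ s)) (Icc 0 τ) := fun hψ =>
    hF.comp (continuousOn_id.prodMk hψ) fun s hs => ⟨hs.1, mem_univ _⟩
  obtain ⟨M₀, hM₀⟩ := (isCompact_Icc (a := (0 : ℝ)) (b := δ)).exists_bound_of_continuousOn
    (hFc (continuousOn_const (c := u₀)))
  set M := M₀ + L * ρ with hM
  have hFM : ∀ s ∈ Icc 0 δ, ∀ v : E, ‖v - u₀‖ ≤ ρ → ‖F s v‖ ≤ M := by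
    intro s hs v hv
    have h1 := hLip' s hs v u₀ hv (by simpa using hρ0.le)
    have h2 := hM₀ s hs
    have h3 : L * ‖v - u₀‖ ≤ L * ρ := by gcongr
    calc ‖F s v‖ = ‖F s u₀ + (F s v - F s u₀)‖ := by congr 1; abel
      _ ≤ ‖F s u₀‖ + ‖F s v - F s u₀‖ := norm_add_le _ _
      _ ≤ M := by linarith
  -- `τ₁` sends curves in the ball into the half ball, as trapping requires; the smaller `τ` also
  -- gives the contraction factor `1/2`.
  obtain ⟨τ₁, hτ₁, hτ₁δ, hτ₁b⟩ := exists_pos_rpow_mul_le ha (C * M) (half_pos hρ0) hδ0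
  obtain ⟨τ, hτ, hττ₁, hτb⟩ := exists_pos_rpow_mul_le ha (C * L) (half_pos one_pos) hτ₁
  have hτδ : τ ≤ δ := hττ₁.trans hτ₁δ
  have hτ1 : τ ≤ 1 := hτδ.trans (min_le_left _ _)
  have hball : ∀ ψ : ℝ → E, ∀ t ∈ Icc 0 τ, (∀ s ∈ Icc 0 t, ‖ψ s - u₀‖ ≤ ρ) →
      ‖volterra K (fun s => F s (ψ s)) t‖ ≤ ρ / 2 := by
    intro ψ t ht hψ
    refine (norm_volterra_le ha hKb ⟨ht.1, ht.2.trans hτ1⟩ fun s hs => ?_).trans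
      (hτ₁b t ⟨ht.1, ht.2.trans hττ₁⟩)
    exact hFM s ⟨hs.1, (hs.2.trans ht.2).trans hτδ⟩ _ (hψ s hs)
  have hcontr : ∀ ψ χ : ℝ → E, ContinuousOn ψ (Icc 0 τ) → ContinuousOn χ (Icc 0 τ) →
      (∀ s ∈ Icc 0 τ, ‖ψ s - u₀‖ ≤ ρ) → (∀ s ∈ Icc 0 τ, ‖χ s - u₀‖ ≤ ρ) → ∀ D : ℝ, 0 ≤ D →
      (∀ s ∈ Icc 0 τ, ‖ψ s - χ s‖ ≤ D) → ∀ t ∈ Icc 0 τ,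
      ‖volterra K (fun s => F s (ψ s)) t - volterra K (fun s => F s (χ s)) t‖ ≤ 1 / 2 * D := by
    intro ψ χ hψc hχc hψ hχ D hD hψχ t ht
    rw [volterra_sub hK ha hKb hτ1 ht (hFc hψc) (hFc hχc)]
    have := norm_volterra_le ha hKb (h := fun s => F s (ψ s) - F s (χ s)) (t := t) (M := L * D)
      ⟨ht.1, ht.2.trans hτ1⟩ fun s hs => by
        have hs' : s ∈ Icc 0 τ := ⟨hs.1, hs.2.trans ht.2⟩
        refine (hLip' s ⟨hs.1, hs'.2.trans hτδ⟩ _ _ (hψ s hs') (hχ s hs')).trans ?_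
        gcongr
        exact hψχ s hs'
    refine this.trans ?_
    have h2 := mul_le_mul_of_nonneg_right (hτb t ht) hD
    linarith
  have hproj : ∀ v : C(Icc (0 : ℝ) τ, E), Continuous (IccExtend hτ.le v) := fun v =>
    v.continuous.Icc_extend'
  let Φ : C(Icc (0 : ℝ) τ, E) → C(Icc (0 : ℝ) τ, E) := fun v =>
    ⟨fun t => u₀ + volterra K (fun s => F s (IccExtend hτ.le v s)) t, by
      have := continuousOn_volterra hK ha hKb hτ.le hτ1 (hFc (hproj v).continuousOn)
      exact continuous_const.add (continuousOn_iff_continuous_domRestrict.1 this)⟩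
  let c₀ : C(Icc (0 : ℝ) τ, E) := ContinuousMap.const _ u₀
  have hmem : ∀ v ∈ Metric.closedBall c₀ ρ, ∀ s, ‖IccExtend hτ.le v s - u₀‖ ≤ ρ := by
    intro v hv s
    rw [← dist_eq_norm]
    exact (ContinuousMap.dist_le hρ0.le).1 hv (projIcc 0 τ hτ.le s)
  have hmaps : MapsTo Φ (Metric.closedBall c₀ ρ) (Metric.closedBall c₀ ρ) := by
    intro v hv
    refine (ContinuousMap.dist_le hρ0.le).2 fun t => ?_
    rw [dist_eq_norm]
    change ‖u₀ + volterra K (fun s => F s (IccExtend hτ.le v s)) t - u₀‖ ≤ ρ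
    rw [add_sub_cancel_left]
    exact (hball _ t t.2 fun s _ => hmem v hv s).trans (by linarith)
  have hcw : ContractingWith (1 / 2) (hmaps.restrict Φ _ _) := by
    refine ⟨by norm_num, LipschitzWith.of_dist_le_mul fun v w => ?_⟩
    refine (ContinuousMap.dist_le (by positivity)).2 fun t => ?_
    rw [dist_eq_norm]
    change ‖(u₀ + volterra K (fun s => F s (IccExtend hτ.le v.1 s)) t) -
      (u₀ + volterra K (fun s => F s (IccExtend hτ.le w.1 s)) t)‖ ≤ _
    rw [add_sub_add_left_eq_sub]
    refine (hcontr _ _ (hproj _).continuousOn (hproj _).continuousOn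
      (fun s _ => hmem _ v.2 s) (fun s _ => hmem _ w.2 s) (dist v w) dist_nonneg ?_ t t.2).trans ?_
    · intro s _
      rw [← dist_eq_norm]
      exact ContinuousMap.dist_apply_le_dist (projIcc 0 τ hτ.le s)
    · simp
  obtain ⟨v, hv, hfix, -⟩ := hcw.exists_fixedPoint' (Metric.isClosed_closedBall.isComplete) hmaps
    (Metric.mem_closedBall_self hρ0.le) (edist_ne_top _ _)
  have hveq : ∀ t ∈ Icc 0 τ, IccExtend hτ.le v t =
      u₀ + volterra K (fun s => F s (IccExtend hτ.le v s)) t := by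
    intro t ht
    rw [IccExtend_of_mem _ _ ht]
    exact (DFunLike.congr_fun hfix ⟨t, ht⟩).symm
  refine ⟨τ, hτ, hτ1, IccExtend hτ.le v, (hproj v).continuousOn, hveq, fun ψ hψ hψeq => ?_⟩
  have hψ0 : ψ 0 = u₀ := by
    rw [hψeq 0 ⟨le_rfl, hτ.le⟩]
    simp [volterra]
  have hψρ : ∀ t ∈ Icc 0 τ, ‖ψ t - u₀‖ ≤ ρ := by
    refine norm_sub_le_of_trapped hρ0 hψ hψ0 fun t ht h => ?_
    rw [hψeq t ht, add_sub_cancel_left]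
    exact hball ψ t ht h
  -- With `D` the maximal distance between the two solutions, attained at `m`, the contraction
  -- estimate at `m` reads `D ≤ D / 2`.
  obtain ⟨m, hm, hmax⟩ := isCompact_Icc.exists_isMaxOn (nonempty_Icc.2 hτ.le)
    (hψ.sub (hproj v).continuousOn).norm
  have hD := hcontr ψ _ hψ (hproj v).continuousOn hψρ (fun s _ => hmem v hv s)
    ‖ψ m - IccExtend hτ.le v m‖ (norm_nonneg _) (fun s hs => hmax hs) m hm
  rw [← add_sub_add_left_eq_sub _ _ u₀, ← hψeq m hm, ← hveq m hm] at hD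
  intro t ht
  have := hmax ht
  rw [mem_ofPred_eq] at this
  rw [← sub_eq_zero, ← norm_le_zero_iff]
  exact this.trans (by simp only [Pi.sub_apply]; linarith)

end Volterra

/-! ### Abel's integral equation on the line -/

section Abel

/-- This is the Beta integral `B(a, 1-a)`. Rescaling produces the factor `L^(a+(1-a)-1) = 1`, so the
value does not depend on `L`. -/
lemma integral_rpow_mul_rpow_sub {a L : ℝ} (ha : a ∈ Ioo (0 : ℝ) 1) (hL : 0 < L) :
    ∫ x in (0 : ℝ)..L, x ^ (a - 1) * (L - x) ^ (-a) = Real.Gamma a * Real.Gamma (1 - a) := by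
  have h1 := Complex.betaIntegral_scaled (a : ℂ) ((1 - a : ℝ) : ℂ) hL
  have h2 := Complex.Gamma_mul_Gamma_eq_betaIntegral (s := (a : ℂ)) (t := ((1 - a : ℝ) : ℂ))
    (by simpa using ha.1) (by simpa using ha.2)
  have e : (a : ℂ) + ((1 - a : ℝ) : ℂ) = 1 := by push_cast; ring
  rw [e, Complex.Gamma_one, one_mul] at h2
  rw [e, sub_self, Complex.cpow_zero, one_mul, ← h2, Complex.Gamma_ofReal, Complex.Gamma_ofReal]
    at h1
  have h3 : ((∫ x in (0 : ℝ)..L, x ^ (a - 1) * (L - x) ^ (-a) : ℝ) : ℂ) =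
      ∫ x in (0 : ℝ)..L, (x : ℂ) ^ ((a : ℂ) - 1) * ((L : ℂ) - x) ^ (((1 - a : ℝ) : ℂ) - 1) := by
    rw [← intervalIntegral.integral_ofReal]
    refine intervalIntegral.integral_congr fun x hx => ?_
    rw [uIcc_of_le hL.le] at hx
    rw [Complex.ofReal_mul, Complex.ofReal_cpow hx.1, Complex.ofReal_cpow (by linarith [hx.2])]
    push_cast
    congr 2
    ring
  rw [h1] at h3
  exact_mod_cast h3

lemma Gamma_mul_Gamma_one_sub_pos {a : ℝ} (ha : a ∈ Ioo (0 : ℝ) 1) :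
    0 < Real.Gamma a * Real.Gamma (1 - a) :=
  mul_pos (Real.Gamma_pos_of_pos ha.1) (Real.Gamma_pos_of_pos (by linarith [ha.2]))

lemma integral_abel_kernel {a r t : ℝ} (ha : a ∈ Ioo (0 : ℝ) 1) (hrt : r < t) :
    ∫ s in r..t, (t - s) ^ (-a) * (s - r) ^ (a - 1) = Real.Gamma a * Real.Gamma (1 - a) := by
  rw [← integral_rpow_mul_rpow_sub ha (sub_pos.2 hrt)]
  have := intervalIntegral.integral_comp_sub_right (a := r) (b := t)
    (fun x : ℝ => x ^ (a - 1) * ((t - r) - x) ^ (-a)) r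
  rw [sub_self] at this
  rw [← this]
  congr 1
  ext s
  rw [mul_comm, sub_sub_sub_cancel_right]

/-- A non-integrable function has integral `0` by convention, so the nonzero value already computed
forces integrability. -/
lemma intervalIntegrable_abel_kernel {a r t : ℝ} (ha : a ∈ Ioo (0 : ℝ) 1) (hrt : r < t) :
    IntervalIntegrable (fun s => (t - s) ^ (-a) * (s - r) ^ (a - 1)) volume r t :=
  intervalIntegral.intervalIntegrable_of_integral_ne_zero <| by
    rw [integral_abel_kernel ha hrt]
    exact (Gamma_mul_Gamma_one_sub_pos ha).ne'

/-- The integrand of the iterated Abel integral, on the triangle `r < s`. -/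
noncomputable def abelIntegrand (a t : ℝ) (h : ℝ → ℝ) (z : ℝ × ℝ) : ℝ :=
  {z : ℝ × ℝ | z.2 < z.1}.indicator
    (fun z => (t - z.1) ^ (-a) * (z.1 - z.2) ^ (a - 1) * h z.2) z

lemma abelIntegrand_left (a t : ℝ) (h : ℝ → ℝ) (r : ℝ) :
    (fun s => abelIntegrand a t h (s, r)) =
      (Ioi r).indicator (fun s => (t - s) ^ (-a) * (s - r) ^ (a - 1) * h r) := by
  ext s
  by_cases hs : r < s <;> simp [abelIntegrand, hs]

lemma abelIntegrand_right (a t : ℝ) (h : ℝ → ℝ) (s : ℝ) :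
    (fun r => abelIntegrand a t h (s, r)) =
      (Iio s).indicator (fun r => (t - s) ^ (-a) * ((s - r) ^ (a - 1) * h r)) := by
  ext r
  by_cases hs : r < s <;> simp [abelIntegrand, hs, mul_assoc]

variable {a t : ℝ} {h : ℝ → ℝ}

lemma integrable_abelIntegrand_left (ha : a ∈ Ioo (0 : ℝ) 1) {r : ℝ} (hr : r ∈ Ioo 0 t) :
    Integrable (fun s => abelIntegrand a t h (s, r)) (volume.restrict (Ioc 0 t)) := by
  rw [abelIntegrand_left, integrable_indicator_iff measurableSet_Ioi, IntegrableOn,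
    Measure.restrict_restrict measurableSet_Ioi, inter_comm, Ioc_inter_Ioi, sup_eq_right.2 hr.1.le]
  exact (intervalIntegrable_iff_integrableOn_Ioc_of_le hr.2.le).1
    ((intervalIntegrable_abel_kernel ha hr.2).mul_const _)

lemma integral_abelIntegrand_left (ha : a ∈ Ioo (0 : ℝ) 1) {r : ℝ} (hr : r ∈ Ioo 0 t) :
    ∫ s in Ioc 0 t, abelIntegrand a t h (s, r) = Real.Gamma a * Real.Gamma (1 - a) * h r := by
  rw [abelIntegrand_left, setIntegral_indicator measurableSet_Ioi, Ioc_inter_Ioi,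
    sup_eq_right.2 hr.1.le, ← intervalIntegral.integral_of_le hr.2.le,
    intervalIntegral.integral_mul_const, integral_abel_kernel ha hr.2]

lemma norm_abelIntegrand_left {r s : ℝ} (hs : s ∈ Ioc 0 t) :
    ‖abelIntegrand a t h (s, r)‖ = abelIntegrand a t (fun r => ‖h r‖) (s, r) := by
  by_cases hrs : r < s
  · have h1 : 0 ≤ (t - s) ^ (-a) := Real.rpow_nonneg (by linarith [hs.2]) _
    have h2 : 0 ≤ (s - r) ^ (a - 1) := Real.rpow_nonneg (by linarith) _
    simp [abelIntegrand, hrs, abs_of_nonneg h1, abs_of_nonneg h2]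
  · simp [abelIntegrand, hrs]

lemma ae_mem_Ioo_of_Ioc : ∀ᵐ r ∂(volume.restrict (Ioc 0 t)), r ∈ Ioo 0 t := by
  rw [← restrict_Ioo_eq_restrict_Ioc]
  exact ae_restrict_mem measurableSet_Ioo

/-- By Tonelli: integrating the absolute value in `s` first leaves `Γ(a) Γ(1-a) |h r|`. This
justifies the exchange of integrals in Abel's identity. -/
lemma integrable_abelIntegrand (ha : a ∈ Ioo (0 : ℝ) 1) (hh : IntegrableOn h (Ioc 0 t)) :
    Integrable (abelIntegrand a t h)
      ((volume.restrict (Ioc 0 t)).prod (volume.restrict (Ioc 0 t))) := by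
  have hm : AEStronglyMeasurable (abelIntegrand a t h)
      ((volume.restrict (Ioc 0 t)).prod (volume.restrict (Ioc 0 t))) := by
    refine AEStronglyMeasurable.indicator ?_ (measurableSet_lt measurable_snd measurable_fst)
    refine AEStronglyMeasurable.mul ?_ hh.aestronglyMeasurable.comp_snd
    refine Measurable.aestronglyMeasurable ?_
    fun_prop
  refine (integrable_prod_iff' hm).2 ⟨?_, ?_⟩
  · filter_upwards [ae_mem_Ioo_of_Ioc] with r hr using integrable_abelIntegrand_left ha hr
  · refine (hh.norm.const_mul (Real.Gamma a * Real.Gamma (1 - a))).congr ?_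
    filter_upwards [ae_mem_Ioo_of_Ioc] with r hr
    rw [← integral_abelIntegrand_left (h := fun r => ‖h r‖) ha hr]
    exact (setIntegral_congr_fun measurableSet_Ioc fun s hs => norm_abelIntegrand_left hs).symm

lemma integral_abelIntegrand_right {s : ℝ} (hs : s ∈ Ioc 0 t) :
    ∫ r in Ioc 0 t, abelIntegrand a t h (s, r) =
      (t - s) ^ (-a) * ∫ r in (0 : ℝ)..s, (s - r) ^ (a - 1) * h r := by
  rw [abelIntegrand_right, setIntegral_indicator measurableSet_Iio,
    intervalIntegral.integral_of_le hs.1.le, integral_Ioc_eq_integral_Ioo, ← integral_const_mul]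
  congr 2
  ext r
  simp only [mem_Ioo, mem_inter_iff, mem_Ioc, mem_Iio]
  exact ⟨fun h => ⟨h.1.1, h.2⟩, fun h => ⟨⟨h.1, h.2.le.trans hs.2⟩, h.2⟩⟩

lemma intervalIntegrable_abel (ha : a ∈ Ioo (0 : ℝ) 1) (ht : 0 ≤ t)
    (hh : IntegrableOn h (Ioc 0 t)) :
    IntervalIntegrable (fun s => (t - s) ^ (-a) * ∫ r in (0 : ℝ)..s, (s - r) ^ (a - 1) * h r)
      volume 0 t := by
  rw [intervalIntegrable_iff_integrableOn_Ioc_of_le ht]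
  exact (integrable_abelIntegrand ha hh).integral_prod_left.congr
    ((ae_restrict_iff' measurableSet_Ioc).2 (.of_forall fun s hs => integral_abelIntegrand_right hs))

/-- Abel's identity: the fractional integrals of orders `a` and `1 - a` compose to the ordinary
integral. -/
lemma integral_abel (ha : a ∈ Ioo (0 : ℝ) 1) (ht : 0 ≤ t) (hh : IntegrableOn h (Ioc 0 t)) :
    ∫ s in (0 : ℝ)..t, (t - s) ^ (-a) * ∫ r in (0 : ℝ)..s, (s - r) ^ (a - 1) * h r =
      Real.Gamma a * Real.Gamma (1 - a) * ∫ r in (0 : ℝ)..t, h r := by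
  rw [intervalIntegral.integral_of_le ht, intervalIntegral.integral_of_le ht, ← integral_const_mul,
    ← setIntegral_congr_fun measurableSet_Ioc fun s hs => integral_abelIntegrand_right hs,
    integral_integral_swap (f := fun s r => abelIntegrand a t h (s, r))
      (integrable_abelIntegrand ha hh)]
  refine integral_congr_ae ?_
  filter_upwards [ae_mem_Ioo_of_Ioc] with r hr using integral_abelIntegrand_left ha hr

/-- An integrable function whose integrals over all initial segments vanish is zero. -/
lemma ae_eq_zero_of_forall_integral_eq_zero {T : ℝ} (hT : 0 ≤ T) (hh : IntegrableOn h (Ioc 0 T))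
    (h0 : ∀ t ∈ Icc 0 T, ∫ s in (0 : ℝ)..t, h s = 0) :
    ∀ᵐ s ∂(volume.restrict (Ioc 0 T)), h s = 0 := by
  -- Lebesgue differentiation: almost everywhere `h` is the derivative of its primitive, which
  -- vanishes identically.
  have hd := ((intervalIntegrable_iff_integrableOn_Ioc_of_le hT).2 hh).ae_hasDerivAt_integral
  filter_upwards [ae_restrict_of_ae hd, ae_mem_Ioo_of_Ioc] with s hs hsI
  rw [uIcc_of_le hT] at hs
  have h1 := hs (Ioo_subset_Icc_self hsI) 0 ⟨le_rfl, hT⟩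
  refine h1.unique ((hasDerivAt_const s (0 : ℝ)).congr_of_eventuallyEq ?_)
  filter_upwards [Icc_mem_nhds hsI.1 hsI.2] with t ht using h0 t ht

/-- Abel's integral equation with zero right-hand side has only the zero solution. -/
lemma ae_eq_zero_of_abel_eq_zero {T : ℝ} (ha : a ∈ Ioo (0 : ℝ) 1) (hT : 0 ≤ T)
    (hh : IntegrableOn h (Ioc 0 T))
    (h0 : ∀ᵐ s ∂(volume.restrict (Ioc 0 T)), ∫ r in (0 : ℝ)..s, (s - r) ^ (a - 1) * h r = 0) :
    ∀ᵐ s ∂(volume.restrict (Ioc 0 T)), h s = 0 := by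
  refine ae_eq_zero_of_forall_integral_eq_zero hT hh fun t ht => ?_
  have h1 := integral_abel ha ht.1 (hh.mono_set (Ioc_subset_Ioc_right ht.2))
  have h2 : ∫ s in (0 : ℝ)..t, (t - s) ^ (-a) * ∫ r in (0 : ℝ)..s, (s - r) ^ (a - 1) * h r = 0 := by
    rw [intervalIntegral.integral_of_le ht.1]
    refine integral_eq_zero_of_ae ?_
    filter_upwards [ae_restrict_of_ae_restrict_of_subset (Ioc_subset_Ioc_right ht.2) h0] with s hs
    simp [hs]
  rw [h2] at h1
  exact (mul_eq_zero.1 h1.symm).resolve_left (Gamma_mul_Gamma_one_sub_pos ha).ne'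

end Abel

/-! ### Bochner integrals in `L^p` and pointwise representatives -/

section Representatives

open Filter Topology

variable {X : Type*} [MeasurableSpace X] {μ : Measure X} {p : ℝ≥0∞} [Fact (1 ≤ p)]

/-- A rapidly converging sequence in `L^p` converges almost everywhere. -/
lemma ae_tendsto_of_norm_sub_le {f : ℕ → Lp ℝ p μ} {g : Lp ℝ p μ}
    (hfg : ∀ k, ‖f k - g‖ ≤ (1 / 2) ^ k) :
    ∀ᵐ x ∂μ, Tendsto (fun k => f k x) atTop (𝓝 (g x)) := by
  have hs : ∑' k, eLpNorm (fun x => f k x - g x) p μ ≠ ∞ := by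
    have h1 : ∀ k, eLpNorm (fun x => f k x - g x) p μ ≤ ENNReal.ofReal ((1 / 2) ^ k) := by
      intro k
      have : eLpNorm (fun x => f k x - g x) p μ = ‖f k - g‖ₑ := by
        rw [Lp.enorm_def]
        exact eLpNorm_congr_ae (Lp.coeFn_sub _ _).symm
      rw [this, ← ofReal_norm]
      exact ENNReal.ofReal_le_ofReal (hfg k)
    refine ne_top_of_le_ne_top ?_ (ENNReal.tsum_le_tsum h1)
    rw [← ENNReal.ofReal_tsum_of_nonneg (fun k => by positivity) summable_geometric_two]
    exact ENNReal.ofReal_ne_top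
  filter_upwards [summable_norm_of_tsum_eLpNorm_ne_top (Fact.out : 1 ≤ p)
    (fun k => (Lp.aestronglyMeasurable (f k)).sub (Lp.aestronglyMeasurable g)) hs] with x hx
  exact tendsto_iff_norm_sub_tendsto_zero.2 hx.tendsto_atTop_zero

/-- A uniformly continuous curve in `L^p` has a jointly measurable representative. -/
lemma exists_measurable_representative {g : ℝ → Lp ℝ p μ} (hg : UniformContinuous g) :
    ∃ G : ℝ × X → ℝ, Measurable G ∧ ∀ s, (fun x => G (s, x)) =ᵐ[μ] g s := by
  have hδ : ∀ k : ℕ, ∃ δ > (0 : ℝ), ∀ s t : ℝ, dist s t < δ → ‖g s - g t‖ ≤ (1 / 2) ^ k := by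
    intro k
    obtain ⟨δ, hδ, h⟩ := Metric.uniformContinuous_iff.1 hg ((1 / 2) ^ k) (by positivity)
    exact ⟨δ, hδ, fun s t hst => by rw [← dist_eq_norm]; exact (h hst).le⟩
  choose δ hδ0 hδ using hδ
  -- Rounding time down to a grid leaves countably many values of the curve, which makes joint
  -- measurability immediate; the mesh `δ k` gives error at most `2^(-k)`.
  let step : ℕ → ℝ → ℝ := fun k s => ⌊s / δ k⌋ * δ k
  have hstep : ∀ k s, dist (step k s) s < δ k := by
    intro k s
    have h1 : s = s / δ k * δ k := (div_mul_cancel₀ s (hδ0 k).ne').symm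
    have h2 : (⌊s / δ k⌋ : ℝ) ≤ s / δ k := Int.floor_le _
    have h3 : s / δ k < ⌊s / δ k⌋ + 1 := Int.lt_floor_add_one _
    rw [Real.dist_eq, abs_sub_comm, abs_of_nonneg]
    · nlinarith [hδ0 k]
    · nlinarith [hδ0 k]
  have hmeas : ∀ k, Measurable fun z : ℝ × X => g (step k z.1) z.2 := by
    intro k
    have h1 : Measurable fun z : ℤ × X => g (z.1 * δ k) z.2 :=
      measurable_from_prod_countable_right fun m =>
        (Lp.stronglyMeasurable (g (m * δ k))).measurable
    exact h1.comp ((Int.measurable_floor.comp (measurable_fst.div_const _)).prodMk measurable_snd)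
  -- The limsup is measurable whether or not the sequence converges, and equals the limit where it
  -- does.
  refine ⟨fun z => limsup (fun k => g (step k z.1) z.2) atTop, Measurable.limsup hmeas, fun s => ?_⟩
  filter_upwards [ae_tendsto_of_norm_sub_le fun k => hδ k _ _ (hstep k s)] with x hx
  exact hx.limsup_eq

/-- Integration over a set of finite measure, as a continuous linear functional on `L^p`. -/
lemma exists_setIntegral_clm {S : Set X} (hS : MeasurableSet S) (hμS : μ S ≠ ∞) :
    ∃ ℓ : Lp ℝ p μ →L[ℝ] ℝ, ∀ g : Lp ℝ p μ, ℓ g = ∫ x in S, g x ∂μ := by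
  -- The functional is the pairing with the indicator of `S`, which lies in the conjugate space
  -- because `μ S` is finite; `p = ∞` needs no separate treatment.
  have : Fact (1 ≤ ENNReal.conjExponent p) := ⟨by simp [ENNReal.conjExponent]⟩
  have : ENNReal.HolderConjugate p (ENNReal.conjExponent p) :=
    ENNReal.HolderConjugate.conjExponent Fact.out
  refine ⟨((ContinuousLinearMap.mul ℝ ℝ).lpPairing μ p (ENNReal.conjExponent p)).flip
    (indicatorConstLp _ hS hμS 1), fun g => ?_⟩
  rw [ContinuousLinearMap.flip_apply, ContinuousLinearMap.lpPairing_eq_integral,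
    ← integral_indicator hS]
  refine integral_congr_ae ?_
  filter_upwards [indicatorConstLp_coeFn (p := ENNReal.conjExponent p) (hs := hS) (hμs := hμS)
    (c := (1 : ℝ))] with x hx
  rw [hx]
  by_cases hxS : x ∈ S <;> simp [hxS]

lemma integrableOn_coeFn {S : Set X} (hμS : μ S ≠ ∞) (g : Lp ℝ p μ) :
    IntegrableOn g S μ := by
  have : IsFiniteMeasure (μ.restrict S) := ⟨by simpa using hμS.lt_top⟩
  exact ((Lp.memLp g).restrict S).integrable Fact.out

/-- Apply the integration functional to `|g|`, whose norm is that of `g`. The resulting local `L^1`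
bound feeds Tonelli on `ν × μ|_S`. -/
lemma exists_integral_norm_le {S : Set X} (hS : MeasurableSet S) (hμS : μ S ≠ ∞) :
    ∃ C : ℝ, ∀ g : Lp ℝ p μ, ∫ x in S, ‖g x‖ ∂μ ≤ C * ‖g‖ := by
  obtain ⟨ℓ, hℓ⟩ := exists_setIntegral_clm (p := p) hS hμS
  refine ⟨‖ℓ‖, fun g => ?_⟩
  have h1 : ∫ x in S, ‖g x‖ ∂μ = ℓ |g| := by
    rw [hℓ]
    refine integral_congr_ae (ae_restrict_of_ae ?_)
    filter_upwards [Lp.coeFn_abs g] with x hx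
    rw [hx, Real.norm_eq_abs]
  rw [h1, ← norm_abs_eq_norm g]
  exact (Real.le_norm_self _).trans (ℓ.le_opNorm _)

variable {ν : Measure ℝ} {F : ℝ → Lp ℝ p μ} {G : ℝ × X → ℝ}

lemma integrable_representative_restrict [SFinite μ] (hF : Integrable F ν)
    (hG : AEStronglyMeasurable G (ν.prod μ)) (hFG : ∀ᵐ s ∂ν, (fun x => G (s, x)) =ᵐ[μ] F s)
    {S : Set X} (hS : MeasurableSet S) (hμS : μ S ≠ ∞) :
    Integrable G (ν.prod (μ.restrict S)) := by
  have hGS : AEStronglyMeasurable G (ν.prod (μ.restrict S)) :=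
    hG.mono_ac (Measure.AbsolutelyContinuous.rfl.prod Measure.restrict_le_self.absolutelyContinuous)
  obtain ⟨C, hC⟩ := exists_integral_norm_le (p := p) hS hμS
  refine (integrable_prod_iff hGS).2 ⟨?_, ?_⟩
  · filter_upwards [hFG] with s hs
    exact (integrableOn_coeFn hμS (F s)).congr (ae_restrict_of_ae hs.symm)
  · refine Integrable.mono' (hF.norm.const_mul C) hGS.norm.integral_prod_right' ?_
    filter_upwards [hFG] with s hs
    rw [Real.norm_of_nonneg (integral_nonneg fun _ => norm_nonneg _)]
    refine le_trans (le_of_eq ?_) (hC (F s))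
    refine integral_congr_ae (ae_restrict_of_ae ?_)
    filter_upwards [hs] with x hx
    rw [hx]

/-- The Bochner integral of a curve in `L^p` is, at almost every point, the Lebesgue integral of a
jointly measurable representative. -/
theorem ae_integrable_and_integral_eq [SFinite ν] [SigmaFinite μ] (hF : Integrable F ν)
    (hG : AEStronglyMeasurable G (ν.prod μ)) (hFG : ∀ᵐ s ∂ν, (fun x => G (s, x)) =ᵐ[μ] F s) :
    ∀ᵐ x ∂μ, Integrable (fun s => G (s, x)) ν ∧ (∫ s, F s ∂ν : Lp ℝ p μ) x = ∫ s, G (s, x) ∂ν := by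
  have hI := fun (S : Set X) (hS : MeasurableSet S) (hμS : μ S < ∞) =>
    integrable_representative_restrict hF hG hFG hS hμS.ne
  have h1 : ∀ᵐ x ∂μ, Integrable (fun s => G (s, x)) ν :=
    ae_of_forall_measure_lt_top_ae_restrict _ fun S hS hμS => (hI S hS hμS).prod_left_ae
  have h2 : (∫ s, F s ∂ν : Lp ℝ p μ) =ᵐ[μ] fun x => ∫ s, G (s, x) ∂ν := by
    -- Both sides are tested on sets of finite measure: the functional passes under the Bochner
    -- integral, and Fubini handles the pointwise integral.
    refine ae_eq_of_forall_setIntegral_eq_of_sigmaFinite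
      (fun S _ hμS => integrableOn_coeFn hμS.ne _)
      (fun S hS hμS => (hI S hS hμS).integral_prod_right) fun S hS hμS => ?_
    obtain ⟨ℓ, hℓ⟩ := exists_setIntegral_clm (p := p) hS hμS.ne
    rw [← hℓ, ← ℓ.integral_comp_comm hF,
      ← integral_integral_swap (f := fun s x => G (s, x)) (hI S hS hμS)]
    refine integral_congr_ae ?_
    filter_upwards [hFG] with s hs
    rw [hℓ]
    exact integral_congr_ae (ae_restrict_of_ae hs.symm)
  filter_upwards [h1, h2] with x hx1 hx2 using ⟨hx1, hx2⟩

/-- The moving domain is a section of a measurable set, so it can be absorbed into an indicator; the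
two orientations of the interval are treated separately. -/
lemma measurable_intervalIntegral {H : (ℝ × X) × ℝ → ℝ} (hH : Measurable H) :
    Measurable fun z : ℝ × X => ∫ s in (0 : ℝ)..z.1, H (z, s) := by
  have key : ∀ A : Set ((ℝ × X) × ℝ), MeasurableSet A →
      Measurable fun z : ℝ × X => ∫ s in {s | (z, s) ∈ A}, H (z, s) := by
    intro A hA
    have : (fun z : ℝ × X => ∫ s in {s | (z, s) ∈ A}, H (z, s)) =
        fun z => ∫ s, A.indicator H (z, s) := by
      ext z
      exact (integral_indicator (measurable_prodMk_left hA : MeasurableSet (Prod.mk z ⁻¹' A))).symm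
    rw [this]
    exact ((hH.indicator hA).stronglyMeasurable.integral_prod_right').measurable
  have e1 : MeasurableSet {w : (ℝ × X) × ℝ | 0 < w.2 ∧ w.2 ≤ w.1.1} :=
    (measurableSet_lt measurable_const measurable_snd).inter
      (measurableSet_le measurable_snd (by fun_prop))
  have e2 : MeasurableSet {w : (ℝ × X) × ℝ | w.1.1 < w.2 ∧ w.2 ≤ 0} :=
    (measurableSet_lt (by fun_prop) measurable_snd).inter
      (measurableSet_le measurable_snd measurable_const)
  exact (key _ e1).sub (key _ e2)

end Representatives

/-! ### The Riemann-Liouville kernel as a multiplication operator -/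

section Kernel

open Filter Topology

variable {X : Type*} [MeasurableSpace X] {μ : Measure X} {p : ℝ≥0∞} [Fact (1 ≤ p)]

/-- Multiplication by an essentially bounded function as an operator on `L^p`. -/
lemma exists_mul_clm {m : X → ℝ} (hm : MemLp m ∞ μ) :
    ∃ M : Lp ℝ p μ →L[ℝ] Lp ℝ p μ, ∀ g : Lp ℝ p μ, M g =ᵐ[μ] fun x => m x * g x := by
  refine ⟨(ContinuousLinearMap.mul ℝ ℝ).holderL μ ∞ p p hm.toLp, fun g => ?_⟩
  rw [ContinuousLinearMap.holderL_apply_apply]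
  filter_upwards [(ContinuousLinearMap.mul ℝ ℝ).coeFn_holder (r := p) hm.toLp g,
    hm.coeFn_toLp] with x hx1 hx2
  rw [hx1, hx2]
  rfl

variable (μ p) in
open Classical in
/-- The operator of multiplication by `m` on `L^p`, and zero if `m` is not essentially bounded. -/
noncomputable def mulOp (m : X → ℝ) : Lp ℝ p μ →L[ℝ] Lp ℝ p μ :=
  if h : MemLp m ∞ μ then (exists_mul_clm h).choose else 0

lemma mulOp_apply {m : X → ℝ} (hm : MemLp m ∞ μ) (g : Lp ℝ p μ) :
    mulOp μ p m g =ᵐ[μ] fun x => m x * g x := by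
  rw [mulOp, dif_pos hm]
  exact (exists_mul_clm hm).choose_spec g

lemma norm_mulOp_le {m : X → ℝ} (hm : MemLp m ∞ μ) {C : ℝ} (hC : 0 ≤ C) (hmC : ∀ x, ‖m x‖ ≤ C) :
    ‖mulOp μ p m‖ ≤ C := by
  refine ContinuousLinearMap.opNorm_le_bound _ hC fun g => ?_
  refine Lp.norm_le_mul_norm_of_ae_le_mul ?_
  filter_upwards [mulOp_apply hm g] with x hx
  rw [hx, norm_mul]
  exact mul_le_mul_of_nonneg_right (hmC x) (norm_nonneg _)

lemma norm_mulOp_sub_le {m n : X → ℝ} (hm : MemLp m ∞ μ) (hn : MemLp n ∞ μ) {C : ℝ} (hC : 0 ≤ C)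
    (hmC : ∀ x, ‖m x - n x‖ ≤ C) : ‖mulOp μ p m - mulOp μ p n‖ ≤ C := by
  refine ContinuousLinearMap.opNorm_le_bound _ hC fun g => ?_
  refine Lp.norm_le_mul_norm_of_ae_le_mul ?_
  rw [sub_apply]
  filter_upwards [mulOp_apply hm g, mulOp_apply hn g,
    Lp.coeFn_sub (mulOp μ p m g) (mulOp μ p n g)] with x hx1 hx2 hx3
  rw [hx3, Pi.sub_apply, hx1, hx2, ← sub_mul, norm_mul]
  exact mul_le_mul_of_nonneg_right (hmC x) (norm_nonneg _)

/-- The Riemann-Liouville kernel `r ^ (α(x) - 1) / Γ(α(x))`. -/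
noncomputable def rlKernel (α : X → ℝ) (r : ℝ) (x : X) : ℝ :=
  1 / Real.Gamma (α x) * r ^ (α x - 1)

variable {α : X → ℝ} {α₀ : ℝ}

lemma continuousOn_inv_Gamma (hα₀ : 0 < α₀) :
    ContinuousOn (fun a => 1 / Real.Gamma a) (Icc α₀ 1) := by
  refine continuousOn_const.div (fun a ha => ?_) fun a ha =>
    (Real.Gamma_pos_of_pos (hα₀.trans_le ha.1)).ne'
  refine (Real.differentiableAt_Gamma fun m h => ?_).continuousAt.continuousWithinAt
  have := Nat.cast_nonneg (α := ℝ) m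
  linarith [ha.1]

lemma measurable_inv_Gamma (hα₀ : 0 < α₀) (hα : Measurable α) (hαI : ∀ x, α x ∈ Icc α₀ 1) :
    Measurable fun x => 1 / Real.Gamma (α x) :=
  (continuousOn_iff_continuous_domRestrict.1 (continuousOn_inv_Gamma hα₀)).measurable.comp
    (hα.subtype_mk (h := hαI))

lemma measurable_rlKernel (hα₀ : 0 < α₀) (hα : Measurable α) (hαI : ∀ x, α x ∈ Icc α₀ 1) :
    Measurable fun z : ℝ × X => rlKernel α z.1 z.2 :=
  ((measurable_inv_Gamma hα₀ hα hαI).comp measurable_snd).mul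
    (measurable_fst.pow ((hα.comp measurable_snd).sub_const 1))

/-- `1/Γ` is bounded on the compact interval `[α₀, 1]`, and for `r ≤ 1` the smallest exponent gives
the largest power. This is why all times are kept below `1`. -/
lemma exists_norm_rlKernel_le {X : Type*} {α : X → ℝ} (hα₀ : 0 < α₀) (hαI : ∀ x, α x ∈ Icc α₀ 1) :
    ∃ C, 0 ≤ C ∧ ∀ r ∈ Ioc (0 : ℝ) 1, ∀ x, ‖rlKernel α r x‖ ≤ C * r ^ (α₀ - 1) := by
  obtain ⟨C, hC⟩ := isCompact_Icc.exists_bound_of_continuousOn (continuousOn_inv_Gamma hα₀)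
  refine ⟨|C|, abs_nonneg C, fun r hr x => ?_⟩
  rw [rlKernel, norm_mul, Real.norm_of_nonneg (Real.rpow_nonneg hr.1.le _)]
  refine mul_le_mul ((hC _ (hαI x)).trans (le_abs_self C)) ?_ (Real.rpow_nonneg hr.1.le _)
    (abs_nonneg C)
  exact Real.rpow_le_rpow_of_exponent_ge hr.1 hr.2 (by linarith [(hαI x).1])

lemma continuousOn_uncurry_rlKernel (hα₀ : 0 < α₀) :
    ContinuousOn (Function.uncurry fun r a : ℝ => 1 / Real.Gamma a * r ^ (a - 1))
      (Ioi 0 ×ˢ Icc α₀ 1) := by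
  refine ((continuousOn_inv_Gamma hα₀).comp continuousOn_snd fun z hz => hz.2).mul ?_
  exact continuousOn_fst.rpow (continuousOn_snd.sub continuousOn_const)
    fun z hz => Or.inl (ne_of_gt hz.1)

lemma memLp_rlKernel (hα₀ : 0 < α₀) (hα : Measurable α) (hαI : ∀ x, α x ∈ Icc α₀ 1) {r : ℝ}
    (hr : 0 < r) : MemLp (rlKernel α r) ∞ μ := by
  have h1 : ContinuousOn (fun a : ℝ => 1 / Real.Gamma a * r ^ (a - 1)) (Icc α₀ 1) :=
    (continuousOn_uncurry_rlKernel hα₀).comp (f := fun a => (r, a)) (by fun_prop)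
      fun a ha => ⟨hr, ha⟩
  obtain ⟨C, hC⟩ := isCompact_Icc.exists_bound_of_continuousOn h1
  exact memLp_top_of_bound
    ((measurable_rlKernel hα₀ hα hαI).comp measurable_prodMk_left).aestronglyMeasurable C
    (.of_forall fun x => hC _ (hαI x))

/-- The kernel depends on `x` only through `α x`, which ranges in a compact interval; continuity in
`r` is therefore uniform in `x`, that is, in operator norm. -/
lemma continuousOn_mulOp_rlKernel (hα₀ : 0 < α₀) (hα : Measurable α)
    (hαI : ∀ x, α x ∈ Icc α₀ 1) :
    ContinuousOn (fun r => mulOp μ p (rlKernel α r)) (Ioi 0) := by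
  intro r hr
  refine Metric.tendsto_nhds.2 fun ε hε => ?_
  obtain ⟨v, hv, h⟩ := isCompact_Icc.mem_uniformity_of_prod (continuousOn_uncurry_rlKernel hα₀) hr
    (Metric.dist_mem_uniformity (half_pos hε))
  filter_upwards [hv, self_mem_nhdsWithin] with s hs hs0
  rw [dist_eq_norm]
  refine (norm_mulOp_sub_le (memLp_rlKernel hα₀ hα hαI hs0) (memLp_rlKernel hα₀ hα hαI hr)
    (half_pos hε).le fun x => ?_).trans_lt (half_lt_self hε)
  have := h s hs (α x) (hαI x)
  rw [← dist_eq_norm]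
  exact (show dist (rlKernel α s x) (rlKernel α r x) < ε / 2 from this).le

end Kernel

/-! ### Bochner and pointwise fractional integrals -/

section Fractional

variable {X : Type*} [MeasurableSpace X] {μ : Measure X} {p : ℝ≥0∞} [Fact (1 ≤ p)]
variable {α : X → ℝ} {α₀ : ℝ}

/-- The fractional integral of variable order of a continuous curve in `L^p`, as a Bochner
integral. -/
noncomputable def bochnerRL (α : X → ℝ) (g : ℝ → Lp ℝ p μ) : ℝ → Lp ℝ p μ :=
  volterra (fun r => mulOp μ p (rlKernel α r)) g

lemma intervalIntegrable_bochnerRL (hα₀ : 0 < α₀) (hα : Measurable α) (hαI : ∀ x, α x ∈ Icc α₀ 1)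
    {g : ℝ → Lp ℝ p μ} (hg : Continuous g) {t : ℝ} (ht : t ∈ Icc (0 : ℝ) 1) :
    IntervalIntegrable (fun r => mulOp μ p (rlKernel α r) (g (t - r))) volume 0 t := by
  obtain ⟨C, hC, hb⟩ := exists_norm_rlKernel_le hα₀ hαI
  refine intervalIntegrable_volterra (continuousOn_mulOp_rlKernel hα₀ hα hαI) hα₀ (C := C)
    (fun r hr => ?_) le_rfl ht hg.continuousOn
  exact norm_mulOp_le (memLp_rlKernel hα₀ hα hαI hr.1)
    (mul_nonneg hC (Real.rpow_nonneg hr.1.le _)) (hb r hr)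

lemma rlIntegral_eq {X : Type*} {α : X → ℝ} {Φ : ℝ → X → ℝ} {t : ℝ} {x : X} (hx : α x ≠ 0) :
    rlIntegral α Φ t x = ∫ r in (0 : ℝ)..t, rlKernel α r x * Φ (t - r) x := by
  rw [rlIntegral, if_neg hx, ← intervalIntegral.integral_const_mul]
  have := intervalIntegral.integral_comp_sub_left (a := 0) (b := t)
    (fun s => 1 / Real.Gamma (α x) * ((t - s) ^ (α x - 1) * Φ s x)) t
  rw [sub_self, sub_zero] at this
  rw [← this]
  congr 1
  ext r
  rw [rlKernel, sub_sub_cancel, mul_assoc]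

variable [SigmaFinite μ]

/-- The Bochner fractional integral agrees with the pointwise one. -/
lemma bochnerRL_ae_eq (hα₀ : 0 < α₀) (hα : Measurable α) (hαI : ∀ x, α x ∈ Icc α₀ 1)
    {g : ℝ → Lp ℝ p μ} (hg : Continuous g) {G : ℝ × X → ℝ} (hG : Measurable G)
    (hGg : ∀ s, (fun x => G (s, x)) =ᵐ[μ] g s) {t : ℝ} (ht : t ∈ Icc (0 : ℝ) 1) :
    bochnerRL α g t =ᵐ[μ] rlIntegral α (fun s x => G (s, x)) t := by
  have h1 := intervalIntegrable_bochnerRL (μ := μ) hα₀ hα hαI hg ht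
  rw [intervalIntegrable_iff_integrableOn_Ioc_of_le ht.1] at h1
  have h2 : Measurable fun z : ℝ × X => rlKernel α z.1 z.2 * G (t - z.1, z.2) :=
    (measurable_rlKernel hα₀ hα hαI).mul
      (hG.comp ((measurable_fst.const_sub t).prodMk measurable_snd))
  have h3 := ae_integrable_and_integral_eq (ν := volume.restrict (Ioc 0 t)) h1
    h2.aestronglyMeasurable ((ae_restrict_iff' measurableSet_Ioc).2 (.of_forall fun r hr => by
      filter_upwards [mulOp_apply (memLp_rlKernel (μ := μ) hα₀ hα hαI hr.1) (g (t - r)),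
        hGg (t - r)] with x hx1 hx2
      rw [hx1, hx2]))
  filter_upwards [h3] with x hx
  rw [bochnerRL, volterra, rlIntegral_eq (hα₀.trans_le (hαI x).1).ne',
    intervalIntegral.integral_of_le ht.1, intervalIntegral.integral_of_le ht.1]
  exact hx.2

lemma measurable_rlIntegral (hα₀ : 0 < α₀) (hα : Measurable α) (hαI : ∀ x, α x ∈ Icc α₀ 1)
    {G : ℝ × X → ℝ} (hG : Measurable G) :
    Measurable fun z : ℝ × X => rlIntegral α (fun s x => G (s, x)) z.1 z.2 := by
  have : (fun z : ℝ × X => rlIntegral α (fun s x => G (s, x)) z.1 z.2) =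
      fun z => ∫ r in (0 : ℝ)..z.1, rlKernel α r z.2 * G (z.1 - r, z.2) :=
    funext fun z => rlIntegral_eq (hα₀.trans_le (hαI z.2).1).ne'
  rw [this]
  refine measurable_intervalIntegral
    (H := fun w => rlKernel α w.2 w.1.2 * G (w.1.1 - w.2, w.1.2)) ?_
  exact ((measurable_rlKernel hα₀ hα hαI).comp
    (measurable_snd.prodMk (measurable_snd.comp measurable_fst))).mul (hG.comp (by fun_prop))

/-- Pointwise composition of the fractional integrals of orders `α(x)` and `1 - α(x)`. -/
lemma rlIntegral_one_sub_rlIntegral {X : Type*} {α : X → ℝ} {Φ : ℝ → X → ℝ} {x : X} (hx : α x ∈ Ioc (0 : ℝ) 1) {t : ℝ}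
    (ht : 0 ≤ t) (hΦ : IntegrableOn (fun s => Φ s x) (Ioc 0 t)) :
    RLIntegralExists (fun x => 1 - α x) (rlIntegral α Φ) t x ∧
      rlIntegral (fun x => 1 - α x) (rlIntegral α Φ) t x = ∫ s in (0 : ℝ)..t, Φ s x := by
  -- Where `α x = 1` the outer operator is the identity and the inner one is ordinary integration;
  -- Abel's identity is needed only for `α x < 1`.
  rcases hx.2.eq_or_lt with h1 | h1
  · refine ⟨Or.inl (by simp [h1]), ?_⟩
    rw [rlIntegral, if_pos (by simp [h1]), rlIntegral, if_neg hx.1.ne']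
    simp [h1]
  · have ha : α x ∈ Ioo (0 : ℝ) 1 := ⟨hx.1, h1⟩
    have e : (fun s => (t - s) ^ ((1 - α x) - 1) * rlIntegral α Φ s x) = fun s =>
        1 / Real.Gamma (α x) *
          ((t - s) ^ (-α x) * ∫ r in (0 : ℝ)..s, (s - r) ^ (α x - 1) * Φ r x) := by
      ext s
      rw [rlIntegral, if_neg hx.1.ne', sub_sub_cancel_left]
      ring
    constructor
    · refine Or.inr ?_
      rw [e]
      exact (intervalIntegrable_abel ha ht hΦ).const_mul _
    · rw [rlIntegral, if_neg (by linarith : (fun x => 1 - α x) x ≠ 0)]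
      rw [e, intervalIntegral.integral_const_mul, integral_abel ha ht hΦ]
      have h2 := (Real.Gamma_pos_of_pos ha.1).ne'
      have h3 := (Real.Gamma_pos_of_pos (sub_pos.2 h1)).ne'
      field_simp

end Fractional

/-! ### Equivalence of the Caputo problem with the Volterra equation -/

section Caputo

open Filter Topology

variable {X : Type*} [MeasurableSpace X] {μ : Measure X} {p : ℝ≥0∞}
variable {α β : X → ℝ} {α₀ τ : ℝ} {I : Set ℝ}

lemma IsRLIntegralOn.congr_order {β' : X → ℝ} (hβ : β =ᵐ[μ] β') {φ v : ℝ → Lp ℝ p μ}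
    (h : IsRLIntegralOn I β φ v) : IsRLIntegralOn I β' φ v := by
  obtain ⟨Φ, hΦ, hv⟩ := h
  refine ⟨Φ, hΦ, fun t ht => ?_⟩
  filter_upwards [hv t ht, hβ] with x hx hβx
  simpa only [RLIntegralExists, rlIntegral, hβx] using hx

lemma HasRLDerivOn.congr_order [Fact (1 ≤ p)] {α' : X → ℝ} (hα : α =ᵐ[μ] α')
    {φ w : ℝ → Lp ℝ p μ} (h : HasRLDerivOn I α φ w) : HasRLDerivOn I α' φ w := by
  obtain ⟨v, hv, hd⟩ := h
  refine ⟨v, hv.congr_order ?_, hd⟩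
  filter_upwards [hα] with x hx
  rw [hx]

lemma IsSolutionOn.congr_order [Fact (1 ≤ p)] {α' : X → ℝ} (hα : α =ᵐ[μ] α')
    {A : Lp ℝ p μ →L[ℝ] Lp ℝ p μ}
    {f : ℝ → Lp ℝ p μ → Lp ℝ p μ} {u₀ : Lp ℝ p μ} {φ : ℝ → Lp ℝ p μ}
    (h : IsSolutionOn I α A f u₀ φ) : IsSolutionOn I α' A f u₀ φ :=
  ⟨h.continuousOn, HasRLDerivOn.congr_order hα h.equation, h.initial⟩

lemma IsRLIntegralOn.sub {φ₁ φ₂ v₁ v₂ : ℝ → Lp ℝ p μ} (h₁ : IsRLIntegralOn I β φ₁ v₁)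
    (h₂ : IsRLIntegralOn I β φ₂ v₂) :
    IsRLIntegralOn I β (fun t => φ₁ t - φ₂ t) (fun t => v₁ t - v₂ t) := by
  obtain ⟨Φ₁, ⟨hm₁, hr₁⟩, hv₁⟩ := h₁
  obtain ⟨Φ₂, ⟨hm₂, hr₂⟩, hv₂⟩ := h₂
  refine ⟨fun t x => Φ₁ t x - Φ₂ t x, ⟨hm₁.sub hm₂, fun t ht => ?_⟩, fun t ht => ?_⟩
  · filter_upwards [hr₁ t ht, hr₂ t ht, Lp.coeFn_sub (φ₁ t) (φ₂ t)] with x hx1 hx2 hx3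
    rw [hx3, Pi.sub_apply, hx1, hx2]
  · filter_upwards [hv₁ t ht, hv₂ t ht, Lp.coeFn_sub (v₁ t) (v₂ t)] with x hx1 hx2 hx3
    rw [hx3, Pi.sub_apply, hx1.2, hx2.2]
    by_cases hβ : β x = 0
    · exact ⟨Or.inl hβ, by simp [rlIntegral, hβ]⟩
    · have i1 := hx1.1.resolve_left hβ
      have i2 := hx2.1.resolve_left hβ
      have e : (fun s => (t - s) ^ (β x - 1) * (Φ₁ s x - Φ₂ s x)) = fun s =>
          (t - s) ^ (β x - 1) * Φ₁ s x - (t - s) ^ (β x - 1) * Φ₂ s x := by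
        ext s
        ring
      refine ⟨Or.inr (e ▸ i1.sub i2), ?_⟩
      simp only [rlIntegral, if_neg hβ, e]
      rw [intervalIntegral.integral_sub i1 i2]
      ring

/-- A fractional integral vanishes at time zero if the curve does. -/
lemma IsRLIntegralOn.eq_zero_at_zero {φ v : ℝ → Lp ℝ p μ} (h : IsRLIntegralOn I β φ v)
    (h0 : 0 ∈ I) (hφ : φ 0 = 0) : v 0 = 0 := by
  obtain ⟨Φ, hΦ, hv⟩ := h
  refine Lp.eq_zero_iff_ae_eq_zero.2 ?_
  have h1 := hΦ.2 0 h0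
  rw [hφ] at h1
  filter_upwards [h1, hv 0 h0, Lp.coeFn_zero ℝ p μ] with x hx1 hx2 hx3
  rw [hx2.2, rlIntegral, intervalIntegral.integral_same, mul_zero, hx1, hx3]
  simp

variable [Fact (1 ≤ p)] [SigmaFinite μ]

/-- The fractional integral of order `α(x)` of a continuous curve has that curve as its
Riemann-Liouville derivative. -/
theorem hasRLDerivOn_bochnerRL (hα₀ : 0 < α₀) (hα : Measurable α) (hαI : ∀ x, α x ∈ Icc α₀ 1)
    (hτ : 0 ≤ τ) (hτ1 : τ ≤ 1) {g w : ℝ → Lp ℝ p μ} (hg : ContinuousOn g (Icc 0 τ))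
    (hw : EqOn w (bochnerRL α g) (Icc 0 τ)) : HasRLDerivOn (Icc 0 τ) α w g := by
  obtain ⟨g', hgu, hgg, -⟩ := exists_continuous_extension hτ hg
  have hgc := hgu.continuous
  obtain ⟨G, hG, hGg⟩ := exists_measurable_representative hgu
  have hlink : ∀ t, 0 ≤ t → ∀ᵐ x ∂μ, IntegrableOn (fun s => G (s, x)) (Ioc 0 t) ∧
      (∫ s in (0 : ℝ)..t, g' s : Lp ℝ p μ) x = ∫ s in (0 : ℝ)..t, G (s, x) := by
    intro t ht
    rw [intervalIntegral.integral_of_le ht]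
    simp_rw [intervalIntegral.integral_of_le ht]
    exact ae_integrable_and_integral_eq
      ((intervalIntegrable_iff_integrableOn_Ioc_of_le ht).1 (hgc.intervalIntegrable 0 t))
      hG.aestronglyMeasurable (.of_forall hGg)
  -- By Abel's identity `J^{1-α}` of the curve is the ordinary primitive, whose derivative comes
  -- from the fundamental theorem of calculus for the extended curve.
  refine ⟨fun t => ∫ s in (0 : ℝ)..t, g' s,
    ⟨rlIntegral α fun s x => G (s, x), ⟨?_, fun t ht => ?_⟩, fun t ht => ?_⟩, fun t ht => ?_⟩
  · exact (measurable_rlIntegral hα₀ hα hαI hG).aestronglyMeasurable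
  · rw [hw ht, bochnerRL, volterra_congr _ ht hgg.symm]
    exact (bochnerRL_ae_eq hα₀ hα hαI hgc hG hGg ⟨ht.1, ht.2.trans hτ1⟩).symm
  · filter_upwards [hlink t ht.1] with x hx
    have := rlIntegral_one_sub_rlIntegral (α := α) (Φ := fun s x => G (s, x)) (x := x)
      ⟨hα₀.trans_le (hαI x).1, (hαI x).2⟩ ht.1 hx.1
    exact ⟨this.1, hx.2.trans this.2.symm⟩
  · rw [← hgg ht]
    exact (hgc.integral_hasStrictDerivAt 0 t).hasDerivAt.hasDerivWithinAt

/-- The fractional integral of order `1 - α(x)` is injective on continuous curves. -/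
theorem IsRLIntegralOn.eq_zero (hα₀ : 0 < α₀) (hα : Measurable α) (hαI : ∀ x, α x ∈ Icc α₀ 1)
    (hτ : 0 < τ) {w v : ℝ → Lp ℝ p μ} (hw : ContinuousOn w (Icc 0 τ))
    (h : IsRLIntegralOn (Icc 0 τ) (fun x => 1 - α x) w v) (hv : ∀ t ∈ Icc 0 τ, v t = 0) :
    ∀ t ∈ Icc 0 τ, w t = 0 := by
  obtain ⟨Φ, ⟨hm, hr⟩, hJ⟩ := h
  rw [restrict_Ioc_eq_restrict_Icc.symm] at hm
  obtain ⟨Ψ, hΨ, hΦΨ⟩ := hm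
  have hs : ∀ᵐ s ∂(volume.restrict (Ioc 0 τ)), (fun x => Φ s x) =ᵐ[μ] fun x => Ψ (s, x) :=
    Measure.ae_ae_of_ae_prod hΦΨ
  have hx : ∀ᵐ x ∂μ, ∀ᵐ s ∂(volume.restrict (Ioc 0 τ)), Φ s x = Ψ (s, x) :=
    Measure.ae_ae_of_ae_prod (Measure.measurePreserving_swap.quasiMeasurePreserving.ae hΦΨ)
  have hΨw : ∀ᵐ s ∂(volume.restrict (Ioc 0 τ)), (fun x => Ψ (s, x)) =ᵐ[μ] w s := by
    filter_upwards [hs, ae_restrict_mem measurableSet_Ioc] with s hs1 hs2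
    exact hs1.symm.trans (hr s (Ioc_subset_Icc_self hs2))
  -- the unnormalized fractional integral
  set R : ℝ × X → ℝ := fun z => if α z.2 = 1 then Ψ z else
    ∫ s in (0 : ℝ)..z.1, (z.1 - s) ^ ((1 - α z.2) - 1) * Ψ (s, z.2) with hR
  have hRm : Measurable R := by
    refine Measurable.ite ?_ hΨ.measurable (measurable_intervalIntegral
      (H := fun w => (w.1.1 - w.2) ^ ((1 - α w.1.2) - 1) * Ψ (w.2, w.1.2)) ?_)
    · exact (hα.comp measurable_snd) (measurableSet_singleton 1)
    · exact (Measurable.pow (by fun_prop) (by fun_prop)).mul (hΨ.measurable.comp (by fun_prop))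
  have hR0 : ∀ᵐ s ∂(volume.restrict (Ioc 0 τ)), ∀ᵐ x ∂μ, R (s, x) = 0 := by
    filter_upwards [hs, ae_restrict_mem measurableSet_Ioc] with s hs1 hs2
    have hJs := hJ s (Ioc_subset_Icc_self hs2)
    rw [hv s (Ioc_subset_Icc_self hs2)] at hJs
    filter_upwards [hs1, hJs, hx, Lp.coeFn_zero ℝ p μ] with x hx1 hx2 hx3 hx4
    have h0 := hx2.2.symm.trans hx4
    rw [Pi.zero_apply, rlIntegral] at h0
    by_cases hα1 : α x = 1
    · rw [if_pos (by simp [hα1]), hx1] at h0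
      simpa [hR, hα1] using h0
    · have hα1' : 0 < 1 - α x := sub_pos.2 (lt_of_le_of_ne (hαI x).2 hα1)
      rw [if_neg hα1'.ne'] at h0
      have h1 := (mul_eq_zero.1 h0).resolve_left
        (one_div_ne_zero (Real.Gamma_pos_of_pos hα1').ne')
      simp only [hR, if_neg hα1]
      refine Eq.trans ?_ h1
      rw [intervalIntegral.integral_of_le hs2.1.le, intervalIntegral.integral_of_le hs2.1.le]
      refine integral_congr_ae ?_
      filter_upwards [ae_restrict_of_ae_restrict_of_subset (Ioc_subset_Ioc_right hs2.2) hx3]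
        with r hr
      rw [hr]
  -- Abel's equation is solved for fixed `x`, so the two almost-everywhere quantifiers must be
  -- exchanged. This needs a measurable zero set, hence `Ψ` in place of the merely a.e. measurable
  -- `Φ`.
  have hR0' : ∀ᵐ x ∂μ, ∀ᵐ s ∂(volume.restrict (Ioc 0 τ)), R (s, x) = 0 :=
    (Measure.ae_ae_comm (p := fun s x => R (s, x) = 0) (hRm (measurableSet_singleton 0))).1 hR0
  have hint : Integrable w (volume.restrict (Ioc 0 τ)) :=
    hw.integrableOn_Icc.mono_set Ioc_subset_Icc_self
  have hΨ0 : ∀ᵐ x ∂μ, ∀ᵐ s ∂(volume.restrict (Ioc 0 τ)), Ψ (s, x) = 0 := by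
    filter_upwards [hR0', ae_integrable_and_integral_eq hint hΨ.aestronglyMeasurable hΨw]
      with x hx1 hx2
    by_cases hα1 : α x = 1
    · filter_upwards [hx1] with s hs
      simpa [hR, hα1] using hs
    · have ha : 1 - α x ∈ Ioo (0 : ℝ) 1 :=
        ⟨sub_pos.2 (lt_of_le_of_ne (hαI x).2 hα1), by linarith [(hαI x).1]⟩
      refine ae_eq_zero_of_abel_eq_zero ha hτ.le hx2.1 ?_
      filter_upwards [hx1] with s hs
      simpa only [hR, if_neg hα1] using hs
  have hΨ0' := (Measure.ae_ae_comm (p := fun x s => Ψ (s, x) = 0)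
    ((hΨ.measurable.comp measurable_swap) (measurableSet_singleton 0))).1 hΨ0
  have hw0 : ∀ᵐ s ∂(volume.restrict (Ioc 0 τ)), w s = 0 := by
    filter_upwards [hΨw, hΨ0'] with s hs1 hs2
    exact Lp.eq_zero_iff_ae_eq_zero.2 (hs1.symm.trans hs2)
  rw [restrict_Ioc_eq_restrict_Icc] at hw0
  exact Measure.eqOn_Icc_of_ae_eq volume hτ.ne hw0 hw continuousOn_const

/-- A continuous curve that vanishes at time zero and has a continuous Riemann-Liouville derivative
is the fractional integral of that derivative. -/
theorem HasRLDerivOn.eqOn_bochnerRL (hα₀ : 0 < α₀) (hα : Measurable α)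
    (hαI : ∀ x, α x ∈ Icc α₀ 1) (hτ : 0 < τ) (hτ1 : τ ≤ 1) {w g : ℝ → Lp ℝ p μ}
    (hg : ContinuousOn g (Icc 0 τ)) (hw : ContinuousOn w (Icc 0 τ)) (hw0 : w 0 = 0)
    (h : HasRLDerivOn (Icc 0 τ) α w g) : EqOn w (bochnerRL α g) (Icc 0 τ) := by
  obtain ⟨v, hv, hvd⟩ := h
  -- `v` and `v'` have the same derivative and both vanish at time zero, so they agree; injectivity
  -- of `J^{1-α}` then identifies `w` with `bochnerRL α g`.
  obtain ⟨v', hv', hvd'⟩ := hasRLDerivOn_bochnerRL hα₀ hα hαI hτ.le hτ1 hg (fun _ _ => rfl)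
  have h0 : (0 : ℝ) ∈ Icc 0 τ := ⟨le_rfl, hτ.le⟩
  have hd : ∀ t ∈ Icc 0 τ, HasDerivWithinAt (fun t => v t - v' t) 0 (Icc 0 τ) t := fun t ht => by
    have := (hvd t ht).sub (hvd' t ht)
    rwa [sub_self] at this
  have hvv : ∀ t ∈ Icc 0 τ, v t - v' t = 0 := by
    intro t ht
    have := constant_of_has_deriv_right_zero (f := fun t => v t - v' t)
      (fun t ht => (hd t ht).continuousWithinAt)
      (fun t ht => (hd t (Ico_subset_Icc_self ht)).mono_of_mem_nhdsWithin
        (Icc_mem_nhdsGE_of_mem ht)) t ht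
    rw [this, hv.eq_zero_at_zero h0 hw0,
      hv'.eq_zero_at_zero h0 (by simp [bochnerRL, volterra]), sub_zero]
  obtain ⟨C, hC, hb⟩ := exists_norm_rlKernel_le hα₀ hαI
  have hwc : ContinuousOn (bochnerRL α g) (Icc 0 τ) :=
    continuousOn_volterra (continuousOn_mulOp_rlKernel hα₀ hα hαI) hα₀ (C := C)
      (fun r hr => norm_mulOp_le (memLp_rlKernel hα₀ hα hαI hr.1)
        (mul_nonneg hC (Real.rpow_nonneg hr.1.le _)) (hb r hr)) hτ.le hτ1 hg
  intro t ht
  exact sub_eq_zero.1 ((hv.sub hv').eq_zero hα₀ hα hαI hτ (hw.sub hwc) hvv t ht)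

/-- Local well-posedness of the Cauchy problem for the Caputo derivative of variable order, over
a `σ`-finite measure space and for a measurable order bounded away from zero. -/
theorem exists_unique_isSolutionOn (hα₀ : 0 < α₀) (hα : Measurable α) (hαI : ∀ x, α x ∈ Icc α₀ 1)
    (A : Lp ℝ p μ →L[ℝ] Lp ℝ p μ) (f : ℝ → Lp ℝ p μ → Lp ℝ p μ)
    (hf : ContinuousOn (fun z : ℝ × Lp ℝ p μ => f z.1 z.2) (Ici (0 : ℝ) ×ˢ univ))
    (hfLip : LocLipschitzSnd f) (u₀ : Lp ℝ p μ) :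
    ∃ τ₀ > (0 : ℝ), ∃ φ : ℝ → Lp ℝ p μ, IsSolutionOn (Icc 0 τ₀) α A f u₀ φ ∧
      ∀ ψ : ℝ → Lp ℝ p μ, IsSolutionOn (Icc 0 τ₀) α A f u₀ ψ → EqOn ψ φ (Icc 0 τ₀) := by
  -- Being bounded, `A` is absorbed into the nonlinearity at the cost of adding `‖A‖` to the
  -- Lipschitz constant.
  have hF : ContinuousOn (fun z : ℝ × Lp ℝ p μ => A z.2 + f z.1 z.2) (Ici (0 : ℝ) ×ˢ univ) :=
    (A.continuous.comp continuous_snd).continuousOn.add hf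
  have hFL : LocLipschitzSnd fun t v => A v + f t v := by
    intro t₀ ht₀ φ₀
    obtain ⟨r₀, hr₀, L₀, hL₀, h⟩ := hfLip t₀ ht₀ φ₀
    refine ⟨r₀, hr₀, ‖A‖ + L₀, by positivity, fun t ht ψ φ hψ hφ => ?_⟩
    calc ‖A ψ + f t ψ - (A φ + f t φ)‖ = ‖A (ψ - φ) + (f t ψ - f t φ)‖ := by
          rw [map_sub]; congr 1; abel
      _ ≤ ‖A (ψ - φ)‖ + ‖f t ψ - f t φ‖ := norm_add_le _ _
      _ ≤ ‖A‖ * ‖ψ - φ‖ + L₀ * ‖ψ - φ‖ := add_le_add (A.le_opNorm _) (h t ht ψ φ hψ hφ)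
      _ = (‖A‖ + L₀) * ‖ψ - φ‖ := by ring
  obtain ⟨C, hC, hb⟩ := exists_norm_rlKernel_le hα₀ hαI
  obtain ⟨τ, hτ, hτ1, u, hu, hueq, huniq⟩ := exists_unique_volterra (C := C) hα₀
    (continuousOn_mulOp_rlKernel (μ := μ) (p := p) hα₀ hα hαI)
    (fun r hr => norm_mulOp_le (memLp_rlKernel hα₀ hα hαI hr.1)
      (mul_nonneg hC (Real.rpow_nonneg hr.1.le _)) (hb r hr)) hF hFL u₀
  have hFc : ∀ {ψ : ℝ → Lp ℝ p μ}, ContinuousOn ψ (Icc 0 τ) →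
      ContinuousOn (fun s => A (ψ s) + f s (ψ s)) (Icc 0 τ) := fun hψ =>
    hF.comp (continuousOn_id.prodMk hψ) fun s hs => ⟨hs.1, mem_univ _⟩
  have hu0 : u 0 = u₀ := by
    rw [hueq 0 ⟨le_rfl, hτ.le⟩]
    simp [volterra]
  refine ⟨τ, hτ, u, ⟨hu, ?_, hu0⟩, fun ψ hψ => ?_⟩
  · refine hasRLDerivOn_bochnerRL hα₀ hα hαI hτ.le hτ1 (hFc hu) fun t ht => ?_
    rw [hu0, hueq t ht, add_sub_cancel_left]
    rfl
  · refine huniq ψ hψ.continuousOn fun t ht => ?_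
    have := HasRLDerivOn.eqOn_bochnerRL hα₀ hα hαI hτ hτ1 (hFc hψ.continuousOn)
      (hψ.continuousOn.sub continuousOn_const) (sub_self _) hψ.equation ht
    rw [← sub_eq_iff_eq_add', ← hψ.initial]
    exact this

end Caputo

end VariableOrder

/-! ### The theorem on a Euclidean domain -/

theorem theorem4p2 {n : ℕ} (Ω : Set (EuclideanSpace ℝ (Fin n))) (hΩ : IsOpen Ω)
    (p : ℝ≥0∞) [Fact (1 ≤ p)]
    (α : EuclideanSpace ℝ (Fin n) → ℝ) (hα : MemLp α ∞ (volume.restrict Ω))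
    (α₀ : ℝ) (hα₀ : α₀ ∈ Ioo (0 : ℝ) 1)
    (hαbd : ∀ᵐ x ∂(volume.restrict Ω), α x ∈ Icc α₀ 1)
    (A : Lp ℝ p (volume.restrict Ω) →L[ℝ] Lp ℝ p (volume.restrict Ω))
    (f : ℝ → Lp ℝ p (volume.restrict Ω) → Lp ℝ p (volume.restrict Ω))
    (hf : ContinuousOn (fun z : ℝ × Lp ℝ p (volume.restrict Ω) => f z.1 z.2)
      (Ici (0 : ℝ) ×ˢ univ))
    (hfLip : VariableOrder.LocLipschitzSnd f)
    (u₀ : Lp ℝ p (volume.restrict Ω)) :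
    ∃ τ₀ > (0 : ℝ), ∃ φ : ℝ → Lp ℝ p (volume.restrict Ω),
      VariableOrder.IsSolutionOn (Icc 0 τ₀) α A f u₀ φ ∧
      ∀ ψ : ℝ → Lp ℝ p (volume.restrict Ω),
        VariableOrder.IsSolutionOn (Icc 0 τ₀) α A f u₀ ψ → EqOn ψ φ (Icc 0 τ₀) := by
  -- Clamping a measurable version of `α` to `[α₀, 1]` changes it only on a null set and makes
  -- measurability and the bounds hold everywhere.
  let α' : EuclideanSpace ℝ (Fin n) → ℝ :=
    fun x => max α₀ (min 1 (hα.aestronglyMeasurable.mk α x))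
  have hαα' : α =ᵐ[volume.restrict Ω] α' := by
    filter_upwards [hα.aestronglyMeasurable.ae_eq_mk, hαbd] with x hx1 hx2
    change α x = max α₀ (min 1 _)
    rw [← hx1, min_eq_right hx2.2, max_eq_right hx2.1]
  have hm : Measurable α' :=
    measurable_const.max
      (measurable_const.min hα.aestronglyMeasurable.stronglyMeasurable_mk.measurable)
  have hI : ∀ x, α' x ∈ Icc α₀ 1 := fun x =>
    ⟨le_max_left _ _, max_le hα₀.2.le (min_le_left _ _)⟩
  obtain ⟨τ, hτ, φ, hφ, huniq⟩ :=
    VariableOrder.exists_unique_isSolutionOn hα₀.1 hm hI A f hf hfLip u₀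
  exact ⟨τ, hτ, φ, hφ.congr_order hαα'.symm, fun ψ hψ => huniq ψ (hψ.congr_order hαα')⟩
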